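/- For a partition $\pi$ of a positive integer, let $l(\pi)$ be its largest part, let $\nu(i)$ be the number of times $i$ appears as a part of $\pi$, and let $L(\pi)=\nu(l(\pi))$ be the number of appearances of the largest part. Let $\mathcal{P}^*(n)$ be the set of partitions of $n$ without gaps, that is, those in which each of the integers $1,2,\dots,l(\pi)$ occurs as a part, and put $$w(n)=\sum_{\substack{\pi\in\mathcal{P}^*(n)\\ \nu(i)\ge 2,\ 1\le i\le l(\pi)}}\frac{L(\pi)(L(\pi)-1)}{2}\prod_{i=1}^{l(\pi)-1}(\nu(i)-1).$$ Let $d(n)$ be the number of positive divisors of $n$, let $p(m)$ be the number of partitions of $m$ for each integer $m\ge 0$ (so $p(0)=1$), put $p(x)=0$ if the rational number $x$ is not a nonnegative integer, and let $\left(\frac{12}{k}\right)$ be the Kronecker symbol. Then for every integer $n\ge 1$, $$w(n)=-2d(n)-\frac12\sum_{k=1}^{\lfloor\sqrt{24n+1}\rfloor}k\left(\frac{12}{k}\right)p\left(n-\frac{k^2-1}{24}\right).$$ -/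

import Mathlib

/-- The largest part `l(π)` of a partition (`0` for the empty partition). -/
def largestPart {n : ℕ} (π : n.Partition) : ℕ := π.parts.sup

/-- `ν(i)`: the number of appearances of `i` as a part of the partition `π`. -/
def appearances {n : ℕ} (π : n.Partition) (i : ℕ) : ℕ := π.parts.count i

/-- `L(π)`: the number of appearances of the largest part of `π`. -/
def largestPartAppearances {n : ℕ} (π : n.Partition) : ℕ := appearances π (largestPart π)

/-- The partition `π` has no gaps: every integer from `1` up to its largest part is a part. -/
def HasNoGaps {n : ℕ} (π : n.Partition) : Prop :=
  ∀ i ∈ Finset.Icc 1 (largestPart π), i ∈ π.parts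

instance {n : ℕ} (π : n.Partition) : Decidable (HasNoGaps π) :=
  inferInstanceAs (Decidable (∀ i ∈ Finset.Icc 1 (largestPart π), i ∈ π.parts))

/-- The condition `ν(i) ≥ 2` for `1 ≤ i ≤ l(π)`. -/
def AppearAtLeastTwice {n : ℕ} (π : n.Partition) : Prop :=
  ∀ i ∈ Finset.Icc 1 (largestPart π), 2 ≤ appearances π i

instance {n : ℕ} (π : n.Partition) : Decidable (AppearAtLeastTwice π) :=
  inferInstanceAs (Decidable (∀ i ∈ Finset.Icc 1 (largestPart π), 2 ≤ appearances π i))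

/-- `𝒫*(n)`: the set of partitions of `n` without gaps. -/
def gapFreePartitions (n : ℕ) : Finset n.Partition := {π | HasNoGaps π}

/-- The weighted partition count `w(n)`: the sum of `L(π)(L(π)-1)/2 * ∏_{i=1}^{l(π)-1} (ν(i)-1)`
over the partitions `π` of `n` without gaps such that `ν(i) ≥ 2` for `1 ≤ i ≤ l(π)`.
Everything is computed in `ℚ`; the product ranges over `1 ≤ i < l(π)`. -/
def weightedCount (n : ℕ) : ℚ :=
  ∑ π ∈ gapFreePartitions n with AppearAtLeastTwice π,
    ((largestPartAppearances π : ℚ) * ((largestPartAppearances π : ℚ) - 1) / 2) *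
      ∏ i ∈ Finset.Ico 1 (largestPart π), ((appearances π i : ℚ) - 1)

/-- The partition function `p`, extended to rational arguments: `p(x)` is the number of partitions
of `x` if `x` is a nonnegative integer (so `p(0) = 1`), and `p(x) = 0` otherwise. -/
def partitionCount (x : ℚ) : ℕ :=
  if x.den = 1 ∧ 0 ≤ x then Fintype.card (Nat.Partition x.num.toNat) else 0

/-- The Kronecker symbol `(a/n)` for an integer `a` and a natural number `n`.
For `n > 0`, write `n = 2^v * m` with `m` odd; then `(a/n) = (a/2)^v * (a/m)`, where `(a/m)` is the
Jacobi symbol and `(a/2)` is `0` for even `a`, `1` for `a ≡ ±1` and `-1` for `a ≡ ±3` modulo `8`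
(this is the character `ZMod.χ₈`). Also `(a/0)` is `1` if `a = ±1` and `0` otherwise. -/
def kroneckerSymbol (a : ℤ) (n : ℕ) : ℤ :=
  if n = 0 then (if a.natAbs = 1 then 1 else 0)
  else ZMod.χ₈ (a : ZMod 8) ^ padicValNat 2 n * jacobiSym a (n / 2 ^ padicValNat 2 n)

/-!
Write `(z)_n = (1 - z) (1 - zq) ⋯ (1 - z q^(n-1))`, `H_k = ∑_{m ≤ k} q^m / (1 - q^m)` and
`D = H_∞ = ∑ d(n) q^n`. A partition counted by `w` with largest part `l` contributes, part by part,

  `W = ∑ w(n) q^n = ∑_{l ≥ 1} q^(l(l+1)) / ((q)_l² (1 - q^l))`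

(`weightedCount_eq_coeff`; two copies of each part are removed, which turns the weights into
binomial coefficients and leaves an ordinary generating function of partitions). Multiply by `(q)_∞`
and expand `(q)_∞ / (q)_l` by Euler's identity. Collecting the terms by the sum `k` of the two
summation indices leaves an inner sum that Van Hamme's identity (`van_hamme`) evaluates to
`H_k / (q)_k`, so that

  `(q)_∞ W = -∑_k (-1)^k q^(k(k+1)/2) H_k / (q)_k`   (`qPochhammer_mul_weighted_sum`).

As `H_k / (q)_k` is the derivative of `1 / (zq)_k` at `z = 1`, the right-hand side is minus the
derivative at `z = 1` of `∑_k (-1)^k q^(k(k+1)/2) / (zq)_k`. A limiting case of the Rogers–Fine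
identity (`sum_fineTerm_zero`) rewrites this series as a sum over pentagonal exponents, whose
derivative still contains the `H_n`. The derivative at `z = 1` of Sylvester's series for `(zq)_∞`
(`sum_sylvesterTerm`) has the same terms in `H_n` and the value `-(q)_∞ D`. Eliminating them leaves

  `2 (q)_∞ W = (q)_∞ - 4 (q)_∞ D - ∑_{n ≥ 0} (-1)^n q^(n(3n+1)/2) (6n+1 - (6n+5) q^(2n+1))`

(`weighted_sum_identity`). The last sum is `∑_k k (12/k) q^((k²-1)/24)`, and division by `(q)_∞`
brings in the partition numbers.

Questions of convergence are avoided by proving the `q`-series identities in commutative rings in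
which `q ^ N = 0`: all series are then sums over `range N`, and they are applied in
`ℚ⟦X⟧ / (X ^ N)` with `N = n + 1`. Reciprocals of `1 - z q ^ (i + 1)` enter as a sequence of
inverses given by hypothesis. Differentiation at `z = 1` is evaluation at `z = 1 + ε` in the dual
numbers.
-/

open Finset

/-! ### Triangular numbers and `q`-Pochhammer symbols -/

/-- The triangular number `n (n + 1) / 2`. The generalised pentagonal number `n (3 n + 1) / 2` is
`n ^ 2 + triangular n`. -/
def triangular (n : ℕ) : ℕ := n * (n + 1) / 2

@[simp] lemma triangular_zero : triangular 0 = 0 := rfl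

lemma triangular_succ (n : ℕ) : triangular (n + 1) = triangular n + (n + 1) := by
  rw [triangular, triangular, show (n + 1) * (n + 1 + 1) = n * (n + 1) + (n + 1) * 2 by ring,
    Nat.add_mul_div_right _ _ two_pos]

lemma le_triangular (n : ℕ) : n ≤ triangular n := by
  cases n with
  | zero => simp
  | succ n => rw [triangular_succ]; omega

lemma triangular_add (l m : ℕ) : triangular (l + m) = triangular l + triangular m + l * m := by
  induction m with
  | zero => simp
  | succ m ih => rw [← add_assoc, triangular_succ, triangular_succ, ih]; ring

lemma triangular_mul_two (n : ℕ) : triangular n * 2 = n * (n + 1) := by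
  induction n with
  | zero => simp
  | succ m ih => rw [triangular_succ, add_mul, ih]; ring

/-- The `q`-Pochhammer symbol `(zq; q)_n = (1 - zq) (1 - zq²) ⋯ (1 - zqⁿ)`. -/
def qPochhammer {A : Type*} [CommRing A] (z q : A) (n : ℕ) : A :=
  ∏ i ∈ range n, (1 - z * q ^ (i + 1))

/-! ### Sylvester's identity and a limiting case of the Rogers–Fine identity -/

section Identities

variable {A : Type*} [CommRing A]

@[simp] lemma qPochhammer_zero (z q : A) : qPochhammer z q 0 = 1 := by simp [qPochhammer]

lemma qPochhammer_succ (z q : A) (n : ℕ) :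
    qPochhammer z q (n + 1) = qPochhammer z q n * (1 - z * q ^ (n + 1)) := prod_range_succ _ _

lemma qPochhammer_succ' (z q : A) (n : ℕ) :
    qPochhammer z q (n + 1) = (1 - z * q) * qPochhammer (z * q) q n := by
  rw [qPochhammer, prod_range_succ', mul_comm, qPochhammer]
  congr 1
  · simp
  · exact prod_congr rfl fun i _ ↦ by ring

/-- The product of the `w i` is the reciprocal of the `q`-Pochhammer symbol. -/
lemma prod_mul_qPochhammer {z q : A} {w : ℕ → A} (hw : ∀ i, w i * (1 - z * q ^ (i + 1)) = 1)
    (n : ℕ) : (∏ i ∈ range n, w i) * qPochhammer z q n = 1 := by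
  rw [qPochhammer, ← prod_mul_distrib]
  exact prod_eq_one fun i _ ↦ hw i

/-- The `n`-th term of Sylvester's series for `(zq; q)_∞`; here `v i` is the reciprocal of
`1 - q ^ (i + 1)`. -/
def sylvesterTerm (v : ℕ → A) (q z : A) (n : ℕ) : A :=
  (-1) ^ n * z ^ n * q ^ (n ^ 2 + triangular n) * (1 - z * q ^ (2 * n + 1)) *
    qPochhammer z q n * ∏ i ∈ range n, v i

/-- The functional equation `S(z) = (1 - zq) S(zq)` of Sylvester's series. -/
lemma sum_sylvesterTerm_step {v : ℕ → A} {q : A} {N : ℕ} (hq : q ^ N = 0)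
    (hv : ∀ i, v i * (1 - q ^ (i + 1)) = 1) (z : A) :
    ∑ n ∈ range N, sylvesterTerm v q z n =
      (1 - z * q) * ∑ n ∈ range N, sylvesterTerm v q (z * q) n := by
  -- The difference of the two sides telescopes along `V`; here `V 0 = 0`, and `V N = 0` since
  -- `q ^ N = 0`.
  set V : ℕ → A := fun n ↦ (-1) ^ n * z ^ n * q ^ (n ^ 2 + triangular n) * qPochhammer z q n *
    (∏ i ∈ range n, v i) * (1 - q ^ n) with hV
  have key : ∀ n, sylvesterTerm v q z n - (1 - z * q) * sylvesterTerm v q (z * q) n =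
      V n - V (n + 1) := by
    intro n
    have h1 := qPochhammer_succ' z q n
    rw [qPochhammer_succ] at h1
    have h2 := hv n
    simp only [hV, sylvesterTerm, prod_range_succ, qPochhammer_succ,
      show (n + 1) ^ 2 + triangular (n + 1) = n ^ 2 + triangular n + (3 * n + 2) by
        rw [triangular_succ]; ring]
    rw [pow_add q (n ^ 2 + triangular n)]
    generalize q ^ (n ^ 2 + triangular n) = Q
    generalize ∏ i ∈ range n, v i = a at *
    generalize qPochhammer z q n = P at *
    generalize qPochhammer (z * q) q n = P' at *
    linear_combination ((-1) ^ n * (z * q) ^ n * Q * (1 - z * q * q ^ (2 * n + 1)) * a) * h1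
      - ((-1) ^ n * z ^ (n + 1) * Q * q ^ (3 * n + 2) * P * (1 - z * q ^ (n + 1)) * a) * h2
  rw [← sub_eq_zero, mul_sum, ← sum_sub_distrib, sum_congr rfl fun n _ ↦ key n, sum_range_sub']
  have : q ^ (N ^ 2 + triangular N) = 0 :=
    pow_eq_zero_of_le ((le_triangular N).trans (Nat.le_add_left _ _)) hq
  simp [hV, this]

/-- **Sylvester's identity** for `(zq; q)_∞`, when `q` is nilpotent. -/
theorem sum_sylvesterTerm {v : ℕ → A} {q : A} {N : ℕ} (hN : 0 < N) (hq : q ^ N = 0)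
    (hv : ∀ i, v i * (1 - q ^ (i + 1)) = 1) (z : A) :
    ∑ n ∈ range N, sylvesterTerm v q z n = qPochhammer z q N := by
  have h : ∀ K z, ∑ n ∈ range N, sylvesterTerm v q z n =
      qPochhammer z q K * ∑ n ∈ range N, sylvesterTerm v q (z * q ^ K) n := by
    intro K
    induction K with
    | zero => simp
    | succ K ih =>
      intro z
      rw [sum_sylvesterTerm_step hq hv, ih, qPochhammer_succ', mul_assoc, pow_succ', mul_assoc]
  rw [h N, hq, mul_zero, sum_eq_single_of_mem 0 (by simpa using hN)]
  · simp [sylvesterTerm]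
  · intro n _ hn
    simp [sylvesterTerm, hn]

/-- The `l`-th term of `∑ (-1) ^ l c ^ l q ^ (l (l - 1) / 2) / (bq; q)_l` for `c = q ^ (2k+1)` and
`b = z q ^ k`; here `w i` is the reciprocal of `1 - z q ^ (i + 1)`. -/
def fineTerm (w : ℕ → A) (q : A) (k l : ℕ) : A :=
  (-1) ^ l * q ^ (2 * k * l + triangular l) * ∏ i ∈ range l, w (k + i)

/-- The recurrence that relates the series with parameters `(b, c)` and `(bq, cq²)`. Its iteration
gives the Rogers–Fine identity. -/
lemma sum_fineTerm_step {w : ℕ → A} {q z : A} {N : ℕ} (hq : q ^ N = 0)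
    (hw : ∀ i, w i * (1 - z * q ^ (i + 1)) = 1) (k : ℕ) :
    ∑ l ∈ range N, fineTerm w q k l = 1 - q ^ (2 * k + 1) -
      q ^ (3 * k + 2) * ((z - q ^ (k + 1)) * w k) * ∑ l ∈ range N, fineTerm w q (k + 1) l := by
  -- The combination of the two series telescopes along `V`, and `V N` vanishes with `q ^ N`.
  set V : ℕ → A := fun l ↦ fineTerm w q k l * (1 - q ^ (2 * k + 1) * q ^ l) with hV
  have key : ∀ l, fineTerm w q k l +
      q ^ (3 * k + 2) * ((z - q ^ (k + 1)) * w k) * fineTerm w q (k + 1) l = V l - V (l + 1) := by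
    intro l
    have h1 : w k * ∏ i ∈ range l, w (k + 1 + i) = (∏ i ∈ range l, w (k + i)) * w (k + l) := by
      rw [← prod_range_succ, prod_range_succ', mul_comm, add_zero]
      congr 1
      exact prod_congr rfl fun i _ ↦ by congr 1; ring
    have h2 := hw (k + l)
    simp only [hV, fineTerm, prod_range_succ]
    rw [show 2 * (k + 1) * l + triangular l = 2 * k * l + triangular l + 2 * l by ring,
      show 2 * k * (l + 1) + triangular (l + 1) = 2 * k * l + triangular l + (2 * k + l + 1) by
        rw [triangular_succ]; ring, pow_add q (2 * k * l + triangular l),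
        pow_add q (2 * k * l + triangular l)]
    generalize q ^ (2 * k * l + triangular l) = Q
    generalize ∏ i ∈ range l, w (k + i) = a at *
    generalize ∏ i ∈ range l, w (k + 1 + i) = a' at *
    linear_combination (q ^ (3 * k + 2) * (z - q ^ (k + 1)) * (-1) ^ l * Q * q ^ (2 * l)) * h1
      - ((-1) ^ l * Q * q ^ (2 * k + l + 1) * a) * h2
  have h := sum_congr rfl fun l (_ : l ∈ range N) ↦ key l
  rw [sum_add_distrib, ← mul_sum, sum_range_sub'] at h
  have h0 : q ^ (2 * k * N + triangular N) = 0 :=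
    pow_eq_zero_of_le ((le_triangular N).trans (Nat.le_add_left _ _)) hq
  rw [eq_sub_iff_add_eq, h]
  simp [hV, fineTerm, h0]

/-- A limiting case of the **Rogers–Fine identity**, when `q` is nilpotent. -/
theorem sum_fineTerm_zero {w : ℕ → A} {q z : A} {N : ℕ} (hq : q ^ N = 0)
    (hw : ∀ i, w i * (1 - z * q ^ (i + 1)) = 1) :
    ∑ l ∈ range N, (-1) ^ l * q ^ triangular l * ∏ i ∈ range l, w i =
      ∑ n ∈ range N, (-1) ^ n * q ^ (n ^ 2 + triangular n) * (1 - q ^ (2 * n + 1)) *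
        ∏ i ∈ range n, ((z - q ^ (i + 1)) * w i) := by
  have h : ∀ K, ∑ l ∈ range N, fineTerm w q 0 l =
      ∑ n ∈ range K, (-1) ^ n * q ^ (n ^ 2 + triangular n) * (1 - q ^ (2 * n + 1)) *
        ∏ i ∈ range n, ((z - q ^ (i + 1)) * w i) +
      (-1) ^ K * q ^ (K ^ 2 + triangular K) * (∏ i ∈ range K, ((z - q ^ (i + 1)) * w i)) *
        ∑ l ∈ range N, fineTerm w q K l := by
    intro K
    induction K with
    | zero => simp
    | succ K ih =>
      rw [ih, sum_fineTerm_step hq hw K, sum_range_succ, prod_range_succ,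
        show (K + 1) ^ 2 + triangular (K + 1) = K ^ 2 + triangular K + (3 * K + 2) by
          rw [triangular_succ]; ring]
      ring
  have h0 : q ^ (N ^ 2 + triangular N) = 0 :=
    pow_eq_zero_of_le ((le_triangular N).trans (Nat.le_add_left _ _)) hq
  simpa [fineTerm, h0] using h N

/-- The partial sum `∑_{m=1}^n q ^ m / (1 - q ^ m)`; here `v i` is the reciprocal of
`1 - q ^ (i + 1)`. -/
def lambertSum (v : ℕ → A) (q : A) (n : ℕ) : A := ∑ i ∈ range n, q ^ (i + 1) * v i

lemma lambertSum_succ (v : ℕ → A) (q : A) (n : ℕ) :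
    lambertSum v q (n + 1) = lambertSum v q n + q ^ (n + 1) * v n := sum_range_succ _ _

end Identities

/-! ### Derivatives at `z = 1` -/

section Derivatives

open DualNumber TrivSqZeroExt

variable {A : Type*} [CommRing A]

lemma inl_pow_eq_zero {q : A} {N : ℕ} (hq : q ^ N = 0) : (inl q : A[ε]) ^ N = 0 := by
  rw [inl_pow, hq, inl_zero]

lemma one_add_eps_pow (n : ℕ) : (1 + ε : A[ε]) ^ n = 1 + inl (n : A) * ε := by
  induction n with
  | zero => simp
  | succ n ih =>
    rw [pow_succ, ih]
    ext
    · simp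
    · simp [add_comm]

/-- The first-order expansion of `(zq; q)_n` at `z = 1`. -/
lemma qPochhammer_one_add_eps {v : ℕ → A} {q : A} (hv : ∀ i, v i * (1 - q ^ (i + 1)) = 1)
    (n : ℕ) : qPochhammer (1 + ε : A[ε]) (inl q) n =
      inl (qPochhammer 1 q n) - inl (qPochhammer 1 q n * lambertSum v q n) * ε := by
  induction n with
  | zero => simp [lambertSum]
  | succ n ih =>
    rw [qPochhammer_succ, ih, qPochhammer_succ, lambertSum_succ, inl_pow]
    have h := hv n
    ext
    · simp
    · simp
      linear_combination (q ^ (n + 1) * qPochhammer 1 q n) * h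

/-- The reciprocal of `1 - (1 + ε) q ^ (i + 1)` in the dual numbers. -/
lemma dual_inverse {v : ℕ → A} {q : A} (hv : ∀ i, v i * (1 - q ^ (i + 1)) = 1) (i : ℕ) :
    (inl (v i) + inl (q ^ (i + 1) * v i ^ 2) * ε : A[ε]) * (1 - (1 + ε) * inl q ^ (i + 1)) = 1 := by
  have h := hv i
  rw [inl_pow]
  ext
  · simpa using h
  · simp
    linear_combination (q ^ (i + 1) * v i) * h

/-- The first-order expansion of `1 / (zq; q)_n` at `z = 1`. -/
lemma prod_dual_inverse (v : ℕ → A) (q : A) (n : ℕ) :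
    ∏ i ∈ range n, (inl (v i) + inl (q ^ (i + 1) * v i ^ 2) * ε : A[ε]) =
      inl (∏ i ∈ range n, v i) + inl ((∏ i ∈ range n, v i) * lambertSum v q n) * ε := by
  induction n with
  | zero => simp [lambertSum]
  | succ n ih =>
    rw [prod_range_succ, ih, prod_range_succ, lambertSum_succ]
    ext
    · simp
    · simp
      ring

/-- The first-order expansion at `z = 1` of `∏_{i=1}^n (z - q ^ i) / (1 - z q ^ i)`: each factor
contributes `(1 + q ^ i) / (1 - q ^ i) = 1 + 2 q ^ i / (1 - q ^ i)`. -/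
lemma prod_dual_ratio {v : ℕ → A} {q : A} (hv : ∀ i, v i * (1 - q ^ (i + 1)) = 1) (n : ℕ) :
    ∏ i ∈ range n, ((1 + ε - inl q ^ (i + 1)) *
      (inl (v i) + inl (q ^ (i + 1) * v i ^ 2) * ε) : A[ε]) =
      1 + inl (n + 2 * lambertSum v q n) * ε := by
  induction n with
  | zero => simp [lambertSum]
  | succ n ih =>
    rw [prod_range_succ, ih, lambertSum_succ, inl_pow]
    have h := hv n
    ext
    · simp
      linear_combination h
    · simp
      linear_combination (q ^ (n + 1) * v n + (n + 2 * lambertSum v q n) + 1) * h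

/-- Euler's pentagonal number theorem, as the case `z = 1` of Sylvester's identity. -/
lemma pentagonal_sum {v : ℕ → A} {q : A} {N : ℕ} (hN : 0 < N) (hq : q ^ N = 0)
    (hv : ∀ i, v i * (1 - q ^ (i + 1)) = 1) :
    ∑ n ∈ range N, (-1) ^ n * q ^ (n ^ 2 + triangular n) * (1 - q ^ (2 * n + 1)) =
      qPochhammer 1 q N := by
  rw [← sum_sylvesterTerm hN hq hv]
  refine sum_congr rfl fun n _ ↦ ?_
  have h := prod_mul_qPochhammer (z := 1) (w := v) (q := q) (by simpa using hv) n
  rw [sylvesterTerm]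
  linear_combination (-(-1) ^ n * q ^ (n ^ 2 + triangular n) * (1 - q ^ (2 * n + 1))) * h

/-- The derivative of Sylvester's identity at `z = 1`. -/
lemma sylvester_derivative {v : ℕ → A} {q : A} {N : ℕ} (hN : 0 < N) (hq : q ^ N = 0)
    (hv : ∀ i, v i * (1 - q ^ (i + 1)) = 1) :
    ∑ n ∈ range N, (-1) ^ n * q ^ (n ^ 2 + triangular n) *
        ((n - lambertSum v q n) * (1 - q ^ (2 * n + 1)) - q ^ (2 * n + 1)) =
      -(qPochhammer 1 q N * lambertSum v q N) := by
  have hv' : ∀ i, (inl (v i) : A[ε]) * (1 - inl q ^ (i + 1)) = 1 := fun i ↦ by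
    rw [inl_pow, ← inl_one, ← inl_sub, ← inl_mul, hv]
  have h := congrArg snd (sum_sylvesterTerm hN (inl_pow_eq_zero hq) hv' (1 + ε))
  rw [qPochhammer_one_add_eps hv, snd_sum] at h
  rw [show -(qPochhammer 1 q N * lambertSum v q N) = snd (inl (qPochhammer 1 q N) -
    inl (qPochhammer 1 q N * lambertSum v q N) * ε : A[ε]) by simp, ← h]
  refine sum_congr rfl fun n _ ↦ ?_
  have hP := prod_mul_qPochhammer (z := 1) (w := v) (q := q) (by simpa using hv) n
  rw [sylvesterTerm, one_add_eps_pow, qPochhammer_one_add_eps hv, inl_pow, inl_pow,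
    show (∏ i ∈ range n, (inl (v i) : A[ε])) = inl (∏ i ∈ range n, v i) from
      (map_prod (inlHom A A) v _).symm,
    show ((-1 : A[ε]) ^ n) = inl ((-1) ^ n) by rw [← inl_pow]; simp]
  simp
  linear_combination (-(-1) ^ n * q ^ (n ^ 2 + triangular n) *
    ((n - lambertSum v q n) * (1 - q ^ (2 * n + 1)) - q ^ (2 * n + 1))) * hP

/-- The derivative at `z = 1` of the limiting case of the Rogers–Fine identity. -/
lemma fine_derivative {v : ℕ → A} {q : A} {N : ℕ} (hq : q ^ N = 0)
    (hv : ∀ i, v i * (1 - q ^ (i + 1)) = 1) :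
    ∑ l ∈ range N, (-1) ^ l * q ^ triangular l * ((∏ i ∈ range l, v i) * lambertSum v q l) =
      ∑ n ∈ range N, (-1) ^ n * q ^ (n ^ 2 + triangular n) * (1 - q ^ (2 * n + 1)) *
        (n + 2 * lambertSum v q n) := by
  have h := congrArg snd (sum_fineTerm_zero (inl_pow_eq_zero hq) (dual_inverse hv))
  rw [snd_sum, snd_sum] at h
  convert h using 2 with n _ n _
  · rw [prod_dual_inverse, inl_pow, show ((-1 : A[ε]) ^ n) = inl ((-1) ^ n) by rw [← inl_pow]; simp]
    simp
  · rw [prod_dual_ratio hv, inl_pow, inl_pow,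
      show ((-1 : A[ε]) ^ n) = inl ((-1) ^ n) by rw [← inl_pow]; simp]
    simp

end Derivatives

/-! ### Van Hamme's identity -/

section VanHamme

variable {A : Type*} [CommRing A]

lemma one_sub_pow_mul_prod_succ {v : ℕ → A} {q : A} (hv : ∀ i, v i * (1 - q ^ (i + 1)) = 1)
    (n : ℕ) : (1 - q ^ (n + 1)) * ∏ i ∈ range (n + 1), v i = ∏ i ∈ range n, v i := by
  rw [prod_range_succ]
  linear_combination (∏ i ∈ range n, v i) * hv n

/-- The `q`-binomial theorem at `1`: the alternating sum of the `q`-binomial coefficients vanishes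
for `k ≥ 1`. It is divided by `(q; q)_(k + 1)`, and its leading term is on the left-hand side. -/
lemma alternating_qBinomial_sum {v : ℕ → A} {q : A} (hv : ∀ i, v i * (1 - q ^ (i + 1)) = 1)
    (k : ℕ) :
    ∑ x ∈ antidiagonal k, (-1) ^ x.1 * q ^ triangular x.1 *
      (∏ i ∈ range (x.1 + 1), v i) * ∏ i ∈ range x.2, v i = ∏ i ∈ range (k + 1), v i := by
  have hs := one_sub_pow_mul_prod_succ hv
  set a : ℕ → A := fun n ↦ ∏ i ∈ range n, v i with ha
  change ∀ n, (1 - q ^ (n + 1)) * a (n + 1) = a n at hs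
  change ∑ x ∈ antidiagonal k, (-1) ^ x.1 * q ^ triangular x.1 * a (x.1 + 1) * a x.2 = a (k + 1)
  suffices h : (1 - q ^ (k + 1)) *
      ∑ x ∈ antidiagonal k, (-1) ^ x.1 * q ^ triangular x.1 * a (x.1 + 1) * a x.2 = a k by
    rw [← hs k] at h
    linear_combination v k * h +
      (a (k + 1) - ∑ x ∈ antidiagonal k, (-1) ^ x.1 * q ^ triangular x.1 * a (x.1 + 1) * a x.2) *
        hv k
  -- Split `1 - q ^ (k + 1) = (1 - q ^ (j + 1)) + q ^ (j + 1) (1 - q ^ m)` for `j + m = k`.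
  have split : (1 - q ^ (k + 1)) *
      ∑ x ∈ antidiagonal k, (-1) ^ x.1 * q ^ triangular x.1 * a (x.1 + 1) * a x.2 =
      ∑ x ∈ antidiagonal k, (-1) ^ x.1 * q ^ triangular x.1 * a x.1 * a x.2 +
      ∑ x ∈ antidiagonal k, (-1) ^ x.1 * q ^ triangular (x.1 + 1) * a (x.1 + 1) *
        ((1 - q ^ x.2) * a x.2) := by
    rw [mul_sum, ← sum_add_distrib]
    refine sum_congr rfl fun x hx ↦ ?_
    rw [← hs x.1, triangular_succ, ← mem_antidiagonal.mp hx]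
    ring
  have h0 : a 0 = 1 := prod_range_zero _
  rw [split]
  cases k with
  | zero => simp [h0]
  | succ k =>
    rw [Nat.sum_antidiagonal_succ, Nat.sum_antidiagonal_succ']
    have h : ∀ x ∈ antidiagonal k,
        (-1) ^ x.1 * q ^ triangular (x.1 + 1) * a (x.1 + 1) *
          ((1 - q ^ (x.2 + 1)) * a (x.2 + 1)) =
        -((-1) ^ (x.1 + 1) * q ^ triangular (x.1 + 1) * a (x.1 + 1) * a x.2) := fun x _ ↦ by
      rw [hs]
      ring
    rw [sum_congr rfl h, sum_neg_distrib]
    simp [ha]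

/-- **Van Hamme's identity**, divided by `(q; q)_(k + 1)`. -/
lemma van_hamme {v : ℕ → A} {q : A} (hv : ∀ i, v i * (1 - q ^ (i + 1)) = 1) (k : ℕ) :
    ∑ x ∈ antidiagonal k, (-1) ^ x.1 * q ^ triangular (x.1 + 1) * v x.1 *
      (∏ i ∈ range (x.1 + 1), v i) * ∏ i ∈ range x.2, v i =
      (∏ i ∈ range (k + 1), v i) * lambertSum v q (k + 1) := by
  have hs := one_sub_pow_mul_prod_succ hv
  have hq := alternating_qBinomial_sum hv
  set a : ℕ → A := fun n ↦ ∏ i ∈ range n, v i with ha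
  change ∀ n, (1 - q ^ (n + 1)) * a (n + 1) = a n at hs
  change ∀ k, ∑ x ∈ antidiagonal k, (-1) ^ x.1 * q ^ triangular x.1 * a (x.1 + 1) * a x.2 =
    a (k + 1) at hq
  set G : ℕ → A := fun k ↦ ∑ x ∈ antidiagonal k, (-1) ^ x.1 * q ^ triangular (x.1 + 1) * v x.1 *
      a (x.1 + 1) * a x.2 with hG
  change G k = a (k + 1) * lambertSum v q (k + 1)
  induction k with
  | zero =>
    simp [hG, ha, lambertSum, triangular]
    ring
  | succ k ih =>
    -- Split `1 - q ^ (k + 2) = (1 - q ^ m) + q ^ m (1 - q ^ (l + 1))` for `l + m = k + 1`.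
    have split : (1 - q ^ (k + 1 + 1)) * G (k + 1) =
        ∑ x ∈ antidiagonal (k + 1), (-1) ^ x.1 * q ^ triangular (x.1 + 1) * v x.1 *
          a (x.1 + 1) * ((1 - q ^ x.2) * a x.2) +
        q ^ (k + 1 + 1) * ∑ x ∈ antidiagonal (k + 1),
          (-1) ^ x.1 * q ^ triangular x.1 * a (x.1 + 1) * a x.2 := by
      rw [hG, mul_sum, mul_sum, ← sum_add_distrib]
      refine sum_congr rfl fun x hx ↦ ?_
      rw [triangular_succ, ← mem_antidiagonal.mp hx]
      linear_combination ((-1) ^ x.1 * q ^ (triangular x.1 + x.1 + 1 + x.2) * a (x.1 + 1) *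
        a x.2) * hv x.1
    have first : ∑ x ∈ antidiagonal (k + 1), (-1) ^ x.1 * q ^ triangular (x.1 + 1) * v x.1 *
        a (x.1 + 1) * ((1 - q ^ x.2) * a x.2) = G k := by
      rw [Nat.sum_antidiagonal_succ']
      simp [hs, hG]
    rw [first, hq, ih] at split
    have h1 : a (k + 1 + 1) = a (k + 1) * v (k + 1) := prod_range_succ _ _
    rw [lambertSum_succ]
    rw [h1] at split ⊢
    linear_combination v (k + 1) * split - G (k + 1) * hv (k + 1)

end VanHamme

/-! ### Euler's expansion and the identity between generating functions -/

section Euler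

variable {A : Type*} [CommRing A]

/-- **Euler's expansion** of `(xq; q)_∞` in powers of `x`, when `q` is nilpotent. -/
theorem sum_euler {v : ℕ → A} {q : A} {N : ℕ} (hN : 0 < N) (hq : q ^ N = 0)
    (hv : ∀ i, v i * (1 - q ^ (i + 1)) = 1) (x : A) :
    ∑ m ∈ range N, (-1) ^ m * q ^ triangular m * x ^ m * ∏ i ∈ range m, v i =
      qPochhammer x q N := by
  set g : A → A := fun x ↦ ∑ m ∈ range N, (-1) ^ m * q ^ triangular m * x ^ m *
    ∏ i ∈ range m, v i with hg
  change g x = _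
  have step : ∀ x, g x = (1 - x * q) * g (x * q) := by
    intro x
    set V : ℕ → A := fun m ↦ (-1) ^ m * q ^ triangular m * x ^ m * (∏ i ∈ range m, v i) *
      (1 - q ^ m) with hV
    have key : ∀ m, (-1) ^ m * q ^ triangular m * x ^ m * (∏ i ∈ range m, v i) -
        (1 - x * q) * ((-1) ^ m * q ^ triangular m * (x * q) ^ m * ∏ i ∈ range m, v i) =
        V m - V (m + 1) := fun m ↦ by
      simp only [hV, prod_range_succ, triangular_succ, pow_add q (triangular m)]
      linear_combination (-(-1) ^ m * q ^ triangular m * q ^ (m + 1) * x ^ (m + 1) *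
        ∏ i ∈ range m, v i) * hv m
    rw [← sub_eq_zero, hg, mul_sum, ← sum_sub_distrib, sum_congr rfl fun m _ ↦ key m,
      sum_range_sub']
    have h0 : q ^ triangular N = 0 := pow_eq_zero_of_le (le_triangular N) hq
    simp [hV, h0]
  have h : ∀ K x, g x = qPochhammer x q K * g (x * q ^ K) := by
    intro K
    induction K with
    | zero => simp
    | succ K ih =>
      intro x
      rw [step, ih, qPochhammer_succ', mul_assoc, pow_succ', mul_assoc]
  have g0 : g 0 = 1 := by
    rw [hg]
    simp only
    rw [sum_eq_single_of_mem 0 (by simpa using hN)]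
    · simp
    · intro n _ hn
      simp [hn]
  rw [h N, hq, mul_zero, g0, mul_one]

lemma qPochhammer_add (q : A) (l n : ℕ) :
    qPochhammer 1 q (l + n) = qPochhammer 1 q l * qPochhammer (q ^ l) q n := by
  rw [qPochhammer, prod_range_add, qPochhammer, qPochhammer]
  congr 1
  exact prod_congr rfl fun i _ ↦ by ring

lemma qPochhammer_one_stable {q : A} {N : ℕ} (hq : q ^ N = 0) (n : ℕ) :
    qPochhammer 1 q (N + n) = qPochhammer 1 q N := by
  rw [qPochhammer_add, hq]
  simp [qPochhammer]

/-- The quotient `(q; q)_∞ / (q; q)_l`, expanded by Euler's identity. -/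
lemma prod_mul_qPochhammer_eq_sum {v : ℕ → A} {q : A} {N : ℕ} (hN : 0 < N) (hq : q ^ N = 0)
    (hv : ∀ i, v i * (1 - q ^ (i + 1)) = 1) (l : ℕ) :
    (∏ i ∈ range l, v i) * qPochhammer 1 q N =
      ∑ m ∈ range N, (-1) ^ m * q ^ (triangular m + l * m) * ∏ i ∈ range m, v i := by
  rw [← qPochhammer_one_stable hq l, add_comm, qPochhammer_add, ← mul_assoc,
    prod_mul_qPochhammer (by simpa using hv), one_mul, ← sum_euler hN hq hv]
  exact sum_congr rfl fun m _ ↦ by ring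

/-- Reordering a double series by the sum of the indices, when the terms with `l + m ≥ N` vanish. -/
lemma sum_range_sum_range_eq_sum_antidiagonal {N : ℕ} {F : ℕ → ℕ → A}
    (hF : ∀ l m, N ≤ l + m → F l m = 0) :
    ∑ l ∈ range N, ∑ m ∈ range N, F l m =
      ∑ k ∈ range N, ∑ x ∈ antidiagonal k, F x.1 x.2 := by
  simp_rw [Nat.sum_antidiagonal_eq_sum_range_succ F]
  rw [sum_range_diag_flip]
  refine sum_congr rfl fun l _ ↦ (sum_subset (by simp) fun m _ hm ↦ hF l m ?_).symm
  simp only [mem_range, not_lt] at hm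
  omega

/-- The generating function of the weighted count in terms of the partial sums
`∑_{m ≤ k} q ^ m / (1 - q ^ m)`. -/
lemma qPochhammer_mul_weighted_sum {v : ℕ → A} {q : A} {N : ℕ} (hN : 0 < N) (hq : q ^ N = 0)
    (hv : ∀ i, v i * (1 - q ^ (i + 1)) = 1) :
    qPochhammer 1 q N *
        ∑ l ∈ range N, q ^ ((l + 1) * (l + 2)) * (∏ i ∈ range (l + 1), v i) ^ 2 * v l =
      -∑ k ∈ range N, (-1) ^ k * q ^ triangular k *
        ((∏ i ∈ range k, v i) * lambertSum v q k) := by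
  set a : ℕ → A := fun n ↦ ∏ i ∈ range n, v i with ha
  set F : ℕ → ℕ → A := fun l m ↦ (-1) ^ (l + m) * q ^ triangular (l + m + 1) *
    ((-1) ^ l * q ^ triangular (l + 1) * v l * a (l + 1) * a m) with hF
  have h1 : ∀ l, qPochhammer 1 q N * (q ^ ((l + 1) * (l + 2)) * a (l + 1) ^ 2 * v l) =
      ∑ m ∈ range N, F l m := by
    intro l
    have h := prod_mul_qPochhammer_eq_sum hN hq hv (l + 1)
    change a (l + 1) * _ = _ at h
    rw [show qPochhammer 1 q N * (q ^ ((l + 1) * (l + 2)) * a (l + 1) ^ 2 * v l) =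
      (q ^ ((l + 1) * (l + 2)) * a (l + 1) * v l) * (a (l + 1) * qPochhammer 1 q N) by ring, h,
      mul_sum]
    refine sum_congr rfl fun m _ ↦ ?_
    rw [hF]
    simp only
    rw [show l + m + 1 = l + 1 + m by ring, triangular_add, ← triangular_mul_two (l + 1)]
    have hs : ((-1 : A) ^ l) * (-1) ^ l = 1 := by rw [← mul_pow]; simp
    rw [pow_add (-1 : A) l m]
    linear_combination (-(-1) ^ m * q ^ (triangular m + (l + 1) * m + triangular (l + 1) * 2) *
      v l * a (l + 1) * a m) * hs
  rw [mul_sum, sum_congr rfl fun l _ ↦ h1 l, sum_range_sum_range_eq_sum_antidiagonal]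
  · have h2 : ∀ k, ∑ x ∈ antidiagonal k, F x.1 x.2 = -((-1) ^ (k + 1) * q ^ triangular (k + 1) *
        (a (k + 1) * lambertSum v q (k + 1))) := by
      intro k
      rw [← van_hamme hv, mul_sum, ← sum_neg_distrib]
      refine sum_congr rfl fun x hx ↦ ?_
      rw [hF, ← mem_antidiagonal.mp hx]
      ring
    rw [sum_congr rfl fun k _ ↦ h2 k, sum_neg_distrib]
    have h3 := sum_range_succ' (fun k ↦ (-1) ^ k * q ^ triangular k * (a k * lambertSum v q k)) N
    have h0 : q ^ triangular N = 0 := pow_eq_zero_of_le (le_triangular N) hq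
    rw [sum_range_succ, h0] at h3
    simp [lambertSum] at h3 ⊢
    exact h3.symm
  · intro l m h
    have h0 : q ^ triangular (l + m + 1) = 0 :=
      pow_eq_zero_of_le (by have := le_triangular (l + m + 1); omega) hq
    simp [hF, h0]

/-- The identity of the theorem between generating functions, multiplied by `2 (q; q)_∞`, when
`q` is nilpotent. -/
theorem weighted_sum_identity {v : ℕ → A} {q : A} {N : ℕ} (hN : 0 < N) (hq : q ^ N = 0)
    (hv : ∀ i, v i * (1 - q ^ (i + 1)) = 1) :
    2 * (qPochhammer 1 q N *
        ∑ l ∈ range N, q ^ ((l + 1) * (l + 2)) * (∏ i ∈ range (l + 1), v i) ^ 2 * v l) =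
      qPochhammer 1 q N - 4 * (qPochhammer 1 q N * lambertSum v q N) -
        ∑ n ∈ range N, (-1) ^ n * q ^ (n ^ 2 + triangular n) *
          ((6 * n + 1) - (6 * n + 5) * q ^ (2 * n + 1)) := by
  rw [qPochhammer_mul_weighted_sum hN hq hv, fine_derivative hq hv]
  have h1 := pentagonal_sum hN hq hv
  have h2 := sylvester_derivative hN hq hv
  -- The partial sums `lambertSum v q n` cancel between the two derivatives.
  have h3 : ∑ n ∈ range N, (-1) ^ n * q ^ (n ^ 2 + triangular n) *
          ((6 * n + 1) - (6 * n + 5) * q ^ (2 * n + 1)) =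
      2 * ∑ n ∈ range N, (-1) ^ n * q ^ (n ^ 2 + triangular n) * (1 - q ^ (2 * n + 1)) *
        (n + 2 * lambertSum v q n) +
      4 * ∑ n ∈ range N, (-1) ^ n * q ^ (n ^ 2 + triangular n) *
        ((n - lambertSum v q n) * (1 - q ^ (2 * n + 1)) - q ^ (2 * n + 1)) +
      ∑ n ∈ range N, (-1) ^ n * q ^ (n ^ 2 + triangular n) * (1 - q ^ (2 * n + 1)) := by
    rw [mul_sum, mul_sum, ← sum_add_distrib, ← sum_add_distrib]
    exact sum_congr rfl fun n _ ↦ by ring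
  rw [h3, h1, h2]
  ring

end Euler

/-! ### Generating functions of partitions and divisors -/

section GeneratingFunctions

open PowerSeries
open scoped PowerSeries.WithPiTopology

/-- One factor of the product formula for `Nat.Partition.genFun`, as a power series in
`X ^ (i + 1)`. -/
lemma genFun_factor_eq_expand {f : ℕ → ℕ → ℚ} (i : ℕ) (hf : f (i + 1) 0 = 1) :
    1 + ∑' j, f (i + 1) (j + 1) • (X : ℚ⟦X⟧) ^ ((i + 1) * (j + 1)) =
      expand (i + 1) i.succ_ne_zero (mk (f (i + 1))) := by
  ext n
  rw [map_add, (Nat.Partition.summable_genFun_term f i).map_tsum _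
    (WithPiTopology.continuous_coeff _ _), coeff_expand]
  simp only [map_smul, coeff_X_pow, coeff_one, coeff_mk, smul_eq_mul, mul_ite, mul_one, mul_zero]
  split_ifs with h0 hd hd
  · subst h0
    rw [Nat.zero_div, hf]
    simp
  · exact absurd (h0 ▸ dvd_zero _) hd
  · obtain ⟨c, rfl⟩ := hd
    obtain ⟨c, rfl⟩ := Nat.exists_eq_add_one_of_ne_zero (right_ne_zero_of_mul h0)
    rw [tsum_eq_single c, Nat.mul_div_cancel_left _ i.succ_pos]
    · simp
    · intro b hb
      rw [if_neg]
      intro h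
      have := Nat.eq_of_mul_eq_mul_left i.succ_pos h
      omega
  · rw [zero_add]
    refine (tsum_congr fun j ↦ if_neg ?_).trans tsum_zero
    rintro rfl
    exact hd (dvd_mul_right _ _)

/-- The product formula for `Nat.Partition.genFun` when the parts are at most `L`. -/
lemma genFun_eq_prod_expand {f : ℕ → ℕ → ℚ} {L : ℕ} (hf : ∀ i, f i 0 = 1)
    (hL : ∀ i c, L < i → f i (c + 1) = 0) :
    Nat.Partition.genFun f =
      ∏ i ∈ range L, expand (i + 1) i.succ_ne_zero (mk (f (i + 1))) := by
  refine (Nat.Partition.hasProd_genFun f).unique ?_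
  rw [← prod_congr rfl fun i _ ↦ genFun_factor_eq_expand i (hf (i + 1))]
  refine hasProd_prod_of_ne_finset_one fun i hi ↦ ?_
  have : L < i + 1 := by simpa [Nat.lt_succ_iff] using hi
  simp [hL _ _ this]

/-- The reciprocal of `1 - X ^ (i + 1)`. -/
noncomputable def geometricSeries (i : ℕ) : ℚ⟦X⟧ := expand (i + 1) i.succ_ne_zero (mk 1)

lemma geometricSeries_mul (i : ℕ) : geometricSeries i * (1 - X ^ (i + 1)) = 1 := by
  have h := congrArg (expand (R := ℚ) (i + 1) i.succ_ne_zero) (mk_one_mul_one_sub_eq_one ℚ)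
  rwa [map_mul, map_sub, expand_X, map_one] at h

lemma geometricSeries_pow (i d : ℕ) : geometricSeries i ^ (d + 1) =
    expand (i + 1) i.succ_ne_zero (mk fun n ↦ ((d + n).choose d : ℚ)) := by
  rw [geometricSeries, ← map_pow, mk_one_pow_eq_mk_choose_add]

lemma coeff_geometricSeries (i n : ℕ) :
    coeff n (geometricSeries i) = if i + 1 ∣ n then 1 else 0 := by
  simp [geometricSeries, coeff_expand]

/-- The product `1 / (X; X)_N` generates the partition numbers up to `N`. -/
lemma coeff_prod_geometricSeries {n N : ℕ} (h : n ≤ N) :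
    coeff n (∏ i ∈ range N, geometricSeries i) = Fintype.card n.Partition := by
  have hgen := genFun_eq_prod_expand (L := N) (f := fun i c ↦ if i ≤ N ∨ c = 0 then (1 : ℚ) else 0)
    (by simp) (fun i c hi ↦ by simp [hi])
  have hprod : ∏ i ∈ range N, geometricSeries i = ∏ i ∈ range N, expand (i + 1) i.succ_ne_zero
      (mk fun c ↦ if i + 1 ≤ N ∨ c = 0 then (1 : ℚ) else 0) := by
    refine prod_congr rfl fun i hi ↦ ?_
    rw [geometricSeries]
    congr 1
    ext c
    have : i + 1 ≤ N := by simpa using hi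
    simp [this]
  rw [hprod, ← hgen, Nat.Partition.coeff_genFun, ← card_univ, card_eq_sum_ones, Nat.cast_sum]
  refine sum_congr rfl fun p _ ↦ ?_
  rw [Nat.cast_one]
  refine prod_eq_one fun i hi ↦ if_pos (Or.inl ?_)
  exact (p.le_of_mem_parts (by simpa using hi)).trans h

/-- The Lambert series `∑ X ^ m / (1 - X ^ m)` generates the number of divisors. -/
lemma coeff_lambertSum {n N : ℕ} (hn : n ≠ 0) (h : n ≤ N) :
    coeff n (lambertSum geometricSeries X N) = n.divisors.card := by
  rw [lambertSum, map_sum]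
  have hc : ∀ i ∈ range N, coeff n ((X : ℚ⟦X⟧) ^ (i + 1) * geometricSeries i) =
      if i + 1 ∣ n then 1 else 0 := by
    intro i _
    rw [coeff_X_pow_mul', coeff_geometricSeries]
    by_cases hd : i + 1 ∣ n
    · rw [if_pos (Nat.le_of_dvd (Nat.pos_of_ne_zero hn) hd), if_pos hd,
        if_pos (Nat.dvd_sub hd dvd_rfl)]
    · rw [if_neg hd]
      split_ifs with h1 h2
      · exact absurd ((Nat.dvd_sub_iff_left h1 dvd_rfl).mp h2) hd
      · rfl
      · rfl
  rw [sum_congr rfl hc, sum_boole, Nat.cast_inj]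
  refine card_bij (fun i _ ↦ i + 1) ?_ ?_ ?_
  · intro i hi
    simpa [hn] using (mem_filter.mp hi).2
  · intro i _ j _ hij
    simpa using hij
  · intro d hd
    have hd' := Nat.mem_divisors.mp hd
    have hle := Nat.le_of_dvd (Nat.pos_of_ne_zero hn) hd'.1
    have hpos := Nat.pos_of_mem_divisors hd
    refine ⟨d - 1, ?_, by omega⟩
    rw [mem_filter, mem_range, Nat.sub_add_cancel hpos]
    exact ⟨by omega, hd'.1⟩

end GeneratingFunctions

/-! ### The generating function of the weighted count -/

section WeightedCount

/-- Two copies of each of the parts `1, …, L`. -/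
def doubledStaircase (L : ℕ) : Multiset ℕ := 2 • (Icc 1 L).val

lemma count_doubledStaircase (L i : ℕ) :
    (doubledStaircase L).count i = if i ∈ Icc 1 L then 2 else 0 := by
  rw [doubledStaircase, Multiset.count_nsmul, Multiset.count_eq_of_nodup (Icc 1 L).nodup]
  simp

lemma mem_doubledStaircase {L i : ℕ} : i ∈ doubledStaircase L ↔ 1 ≤ i ∧ i ≤ L := by
  rw [← Multiset.count_pos, count_doubledStaircase, ← mem_Icc]
  split_ifs with h <;> simp [h]

lemma sum_doubledStaircase (L : ℕ) : (doubledStaircase L).sum = L * (L + 1) := by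
  rw [doubledStaircase, Multiset.sum_nsmul, smul_eq_mul]
  induction L with
  | zero => simp
  | succ L ih =>
    have h : (Icc 1 (L + 1)).val.sum = (Icc 1 L).val.sum + (L + 1) := by
      have h1 := sum_Icc_succ_top (show 1 ≤ L + 1 by omega) (fun i : ℕ ↦ i)
      simpa only [Finset.sum, Multiset.map_id'] using h1
    rw [h, mul_add, ih]
    ring

lemma AppearAtLeastTwice.doubledStaircase_le {n : ℕ} {π : n.Partition}
    (h : AppearAtLeastTwice π) : doubledStaircase (largestPart π) ≤ π.parts := by
  rw [Multiset.le_iff_count]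
  intro i
  rw [count_doubledStaircase]
  split_ifs with hi
  · exact h i hi
  · exact Nat.zero_le _

lemma AppearAtLeastTwice.hasNoGaps {n : ℕ} {π : n.Partition}
    (h : AppearAtLeastTwice π) : HasNoGaps π := fun i hi ↦
  Multiset.count_pos.mp (lt_of_lt_of_le two_pos (h i hi))

/-- The weight of a partition in `weightedCount`. -/
def partitionWeight {n : ℕ} (π : n.Partition) : ℚ :=
  ((largestPartAppearances π : ℚ) * ((largestPartAppearances π : ℚ) - 1) / 2) *
      ∏ i ∈ Ico 1 (largestPart π), ((appearances π i : ℚ) - 1)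

/-- The weight of `c` further appearances of the part `i`, beyond the two that are required, in a
partition with largest part `L`. -/
def extraWeight (L i c : ℕ) : ℚ :=
  if i < L then ((1 + c).choose 1 : ℚ) else if i = L then ((2 + c).choose 2 : ℚ) else
    if c = 0 then 1 else 0

lemma extraWeight_zero (L i : ℕ) : extraWeight L i 0 = 1 := by simp [extraWeight]

/-- Adding two copies of each of the parts `1, …, L` to a partition. -/
def addStaircase {n L : ℕ} (hL : L * (L + 1) ≤ n) (p : (n - L * (L + 1)).Partition) :
    n.Partition where
  parts := p.parts + doubledStaircase L
  parts_pos {i} hi := by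
    rcases Multiset.mem_add.mp hi with h | h
    · exact p.parts_pos h
    · exact (mem_doubledStaircase.mp h).1
  parts_sum := by
    rw [Multiset.sum_add, p.parts_sum, sum_doubledStaircase, Nat.sub_add_cancel hL]

lemma largestPart_addStaircase {n L : ℕ} (h1 : 1 ≤ L) (hL : L * (L + 1) ≤ n)
    {p : (n - L * (L + 1)).Partition} (hp : ∀ i ∈ p.parts, i ≤ L) :
    largestPart (addStaircase hL p) = L := by
  apply le_antisymm
  · refine Multiset.sup_le.mpr fun i hi ↦ ?_
    rcases Multiset.mem_add.mp hi with h | h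
    · exact hp i h
    · exact (mem_doubledStaircase.mp h).2
  · exact Multiset.le_sup (Multiset.mem_add.mpr (Or.inr (mem_doubledStaircase.mpr ⟨h1, le_rfl⟩)))

lemma appearances_addStaircase {n L : ℕ} (hL : L * (L + 1) ≤ n)
    (p : (n - L * (L + 1)).Partition) (i : ℕ) :
    appearances (addStaircase hL p) i = p.parts.count i + if i ∈ Icc 1 L then 2 else 0 := by
  rw [appearances, addStaircase, Multiset.count_add, count_doubledStaircase]

lemma partitionWeight_addStaircase {n L : ℕ} (h1 : 1 ≤ L) (hL : L * (L + 1) ≤ n)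
    {p : (n - L * (L + 1)).Partition} (hp : ∀ i ∈ p.parts, i ≤ L) :
    partitionWeight (addStaircase hL p) = p.parts.toFinsupp.prod (extraWeight L) := by
  have hsub : p.parts.toFinsupp.support ⊆ Icc 1 L := fun i hi ↦ by
    have hi' : i ∈ p.parts := by simpa using hi
    exact mem_Icc.mpr ⟨p.parts_pos hi', hp i hi'⟩
  rw [Finsupp.prod_of_support_subset _ hsub _ fun i _ ↦ extraWeight_zero L i,
    ← Ico_insert_right h1, prod_insert (by simp), partitionWeight, largestPartAppearances,
    largestPart_addStaircase h1 hL hp]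
  congr 1
  · rw [appearances_addStaircase, if_pos (by simp [h1]), Multiset.toFinsupp_apply, extraWeight,
      if_neg (lt_irrefl L), if_pos rfl, Nat.cast_choose_two]
    push_cast
    ring
  · refine prod_congr rfl fun i hi ↦ ?_
    have hi' := mem_Ico.mp hi
    rw [appearances_addStaircase, if_pos (by simp; omega), Multiset.toFinsupp_apply, extraWeight,
      if_pos hi'.2, Nat.choose_one_right]
    push_cast
    ring

/-- Removing two copies of each part turns the weighted count of the partitions with largest part
`L` into a sum over all partitions of `n - L (L + 1)`. -/
lemma sum_partitionWeight_largestPart {n L : ℕ} (h1 : 1 ≤ L) (hL : L * (L + 1) ≤ n) :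
    ∑ π : n.Partition with AppearAtLeastTwice π ∧ largestPart π = L, partitionWeight π =
      ∑ p : (n - L * (L + 1)).Partition, p.parts.toFinsupp.prod (extraWeight L) := by
  have hz : ∀ p ∈ (univ : Finset (n - L * (L + 1)).Partition),
      p.parts.toFinsupp.prod (extraWeight L) ≠ 0 → ∀ i ∈ p.parts, i ≤ L := by
    intro p _ h i hi
    by_contra! hlt
    refine h (prod_eq_zero (i := i) (by simpa using hi) ?_)
    rw [extraWeight, if_neg (by omega), if_neg (by omega), if_neg]
    simpa [Multiset.count_eq_zero] using hi
  rw [← sum_filter_of_ne hz]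
  symm
  refine sum_bij (fun p _ ↦ addStaircase hL p) ?_ ?_ ?_ ?_
  · intro p hp
    have hp' := (mem_filter.mp hp).2
    have hl := largestPart_addStaircase h1 hL hp'
    refine mem_filter.mpr ⟨mem_univ _, fun i hi ↦ ?_, hl⟩
    rw [hl] at hi
    rw [appearances_addStaircase, if_pos hi]
    omega
  · intro p _ p' _ h
    have := congrArg Nat.Partition.parts h
    exact Nat.Partition.ext (add_right_cancel this)
  · intro π hπ
    obtain ⟨-, h2, rfl⟩ := mem_filter.mp hπ
    have hle := h2.doubledStaircase_le
    refine ⟨⟨π.parts - doubledStaircase (largestPart π), fun hi ↦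
      π.parts_pos (Multiset.mem_of_le (Multiset.sub_le_self _ _) hi), ?_⟩, ?_, ?_⟩
    · have := congrArg Multiset.sum (Multiset.sub_add_cancel hle)
      rw [Multiset.sum_add, sum_doubledStaircase, π.parts_sum] at this
      omega
    · exact mem_filter.mpr ⟨mem_univ _, fun i hi ↦
        Multiset.le_sup (Multiset.mem_of_le (Multiset.sub_le_self _ _) hi)⟩
    · exact Nat.Partition.ext (Multiset.sub_add_cancel hle)
  · intro p hp
    exact (partitionWeight_addStaircase h1 hL (mem_filter.mp hp).2).symm

open PowerSeries

lemma genFun_extraWeight (l : ℕ) : Nat.Partition.genFun (extraWeight (l + 1)) =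
    (∏ i ∈ range (l + 1), geometricSeries i) ^ 2 * geometricSeries l := by
  rw [genFun_eq_prod_expand (L := l + 1) (extraWeight_zero _), prod_range_succ, prod_range_succ]
  · have h1 : ∀ i ∈ range l, expand (i + 1) i.succ_ne_zero (mk (extraWeight (l + 1) (i + 1))) =
        geometricSeries i ^ 2 := by
      intro i hi
      rw [geometricSeries_pow]
      congr 2
      ext c
      rw [extraWeight, if_pos (by simpa using hi)]
    have h2 : expand (l + 1) l.succ_ne_zero (mk (extraWeight (l + 1) (l + 1))) =
        geometricSeries l ^ 3 := by
      rw [geometricSeries_pow]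
      congr 2
      ext c
      rw [extraWeight, if_neg (lt_irrefl _), if_pos rfl]
    rw [prod_congr rfl h1, h2, prod_pow]
    ring
  · intro i c hi
    rw [extraWeight, if_neg (by omega), if_neg (by omega), if_neg (by omega)]

/-- The generating function of the weighted count. -/
lemma weightedCount_eq_coeff {n N : ℕ} (hn : 1 ≤ n) (hN : n ≤ N) :
    weightedCount n = coeff n (∑ l ∈ range N, (X : ℚ⟦X⟧) ^ ((l + 1) * (l + 2)) *
      (∏ i ∈ range (l + 1), geometricSeries i) ^ 2 * geometricSeries l) := by
  have hw : weightedCount n = ∑ π : n.Partition with AppearAtLeastTwice π, partitionWeight π := by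
    rw [weightedCount, gapFreePartitions, filter_filter]
    refine sum_congr (filter_congr fun π _ ↦ ?_) fun _ _ ↦ rfl
    exact ⟨And.right, fun h ↦ ⟨h.hasNoGaps, h⟩⟩
  have hl : ∀ π : n.Partition, 1 ≤ largestPart π ∧ largestPart π ≤ n := by
    intro π
    refine ⟨?_, Multiset.sup_le.mpr fun i hi ↦ π.le_of_mem_parts hi⟩
    by_contra! h0
    have : π.parts = 0 := Multiset.eq_zero_of_forall_notMem fun i hi ↦ by
      have := π.parts_pos hi
      have := Multiset.le_sup hi
      rw [largestPart] at h0
      omega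
    have hs := π.parts_sum
    rw [this, Multiset.sum_zero] at hs
    omega
  rw [hw, map_sum, ← sum_fiberwise_of_maps_to (t := range N) (g := fun π ↦ largestPart π - 1)]
  · refine sum_congr rfl fun l _ ↦ ?_
    rw [filter_filter, mul_assoc, ← genFun_extraWeight, coeff_X_pow_mul']
    have hf : univ.filter (fun π : n.Partition ↦ AppearAtLeastTwice π ∧ largestPart π - 1 = l) =
        univ.filter fun π ↦ AppearAtLeastTwice π ∧ largestPart π = l + 1 := by
      refine filter_congr fun π _ ↦ and_congr_right fun _ ↦ ?_
      have := (hl π).1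
      omega
    rw [hf]
    split_ifs with h
    · rw [Nat.Partition.coeff_genFun]
      exact sum_partitionWeight_largestPart (by omega) h
    · refine sum_eq_zero fun π hπ ↦ absurd ?_ h
      obtain ⟨-, h2, h3⟩ := mem_filter.mp hπ
      have := congrArg Multiset.sum (Multiset.sub_add_cancel h2.doubledStaircase_le)
      rw [Multiset.sum_add, sum_doubledStaircase, π.parts_sum, h3] at this
      exact le_of_add_le_right this.le
  · intro π _
    have := hl π
    simp
    omega

end WeightedCount

/-! ### The Kronecker symbol of 12 -/

section Kronecker

lemma kroneckerSymbol_twelve_even {k : ℕ} (h0 : k ≠ 0) (hk : 2 ∣ k) : kroneckerSymbol 12 k = 0 := by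
  have hp : padicValNat 2 k ≠ 0 := by
    have := one_le_padicValNat_of_dvd h0 hk
    omega
  have hchi : ZMod.χ₈ ((12 : ℤ) : ZMod 8) = 0 := by decide
  rw [kroneckerSymbol, if_neg h0, hchi, zero_pow hp, zero_mul]

lemma kroneckerSymbol_twelve_odd {k : ℕ} (hk : k % 2 = 1) :
    kroneckerSymbol 12 k = jacobiSym 3 (k % 12) := by
  have hp : padicValNat 2 k = 0 := padicValNat.eq_zero_of_not_dvd (by omega)
  rw [kroneckerSymbol, if_neg (by omega), hp, pow_zero, pow_zero, one_mul, Nat.div_one,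
    ← jacobiSym.div_four_left (by norm_num) hk]
  exact jacobiSym.mod_right' 3 (Nat.odd_iff.mpr hk)

lemma kroneckerSymbol_twelve_six_mul_add_three (m : ℕ) : kroneckerSymbol 12 (6 * m + 3) = 0 := by
  rw [kroneckerSymbol_twelve_odd (by omega)]
  rcases Nat.even_or_odd' m with ⟨t, rfl | rfl⟩
  · rw [show (6 * (2 * t) + 3) % 12 = 3 by omega]
    norm_num
  · rw [show (6 * (2 * t + 1) + 3) % 12 = 9 by omega]
    norm_num

lemma kroneckerSymbol_twelve_six_mul_add_one (m : ℕ) :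
    kroneckerSymbol 12 (6 * m + 1) = (-1) ^ m := by
  rw [kroneckerSymbol_twelve_odd (by omega)]
  rcases Nat.even_or_odd' m with ⟨t, rfl | rfl⟩
  · rw [show (6 * (2 * t) + 1) % 12 = 1 by omega, pow_mul]
    norm_num
  · rw [show (6 * (2 * t + 1) + 1) % 12 = 7 by omega, pow_succ, pow_mul]
    norm_num

lemma kroneckerSymbol_twelve_six_mul_add_five (m : ℕ) :
    kroneckerSymbol 12 (6 * m + 5) = -(-1) ^ m := by
  rw [kroneckerSymbol_twelve_odd (by omega)]
  rcases Nat.even_or_odd' m with ⟨t, rfl | rfl⟩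
  · rw [show (6 * (2 * t) + 5) % 12 = 5 by omega, pow_mul]
    norm_num
  · rw [show (6 * (2 * t + 1) + 5) % 12 = 11 by omega, pow_succ, pow_mul]
    norm_num

end Kronecker

/-! ### The sum over the partition numbers -/

section PartitionSum

lemma partitionCount_of_neg {x : ℚ} (hx : x < 0) : partitionCount x = 0 :=
  if_neg fun h ↦ absurd h.2 (not_le.mpr hx)

lemma partitionCount_natCast_sub (n e : ℕ) : partitionCount ((n : ℚ) - (e : ℚ)) =
    if e ≤ n then Fintype.card (n - e).Partition else 0 := by
  split_ifs with h
  · rw [← Nat.cast_sub h, partitionCount, if_pos ⟨Rat.den_natCast _, Nat.cast_nonneg _⟩,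
      Rat.num_natCast, Int.toNat_natCast]
  · exact partitionCount_of_neg (sub_neg.mpr (by exact_mod_cast not_le.mp h))

/-- The summand of the theorem's right-hand side. -/
def kroneckerSummand (n k : ℕ) : ℚ :=
  (k : ℚ) * (kroneckerSymbol 12 k : ℚ) *
    (partitionCount ((n : ℚ) - ((k : ℚ) ^ 2 - 1) / 24) : ℚ)

lemma triangular_cast (m : ℕ) : (triangular m : ℚ) = m * (m + 1) / 2 := by
  rw [eq_div_iff two_ne_zero]
  exact_mod_cast triangular_mul_two m

lemma kroneckerSummand_six_mul_add_one (n m : ℕ) : kroneckerSummand n (6 * m + 1) =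
    (-1) ^ m * (6 * m + 1) * if m ^ 2 + triangular m ≤ n then
      (Fintype.card (n - (m ^ 2 + triangular m)).Partition : ℚ) else 0 := by
  have h : ((n : ℚ) - (((6 * m + 1 : ℕ) : ℚ) ^ 2 - 1) / 24) =
      (n : ℚ) - ((m ^ 2 + triangular m : ℕ) : ℚ) := by
    push_cast
    rw [triangular_cast]
    ring
  rw [kroneckerSummand, h, partitionCount_natCast_sub, kroneckerSymbol_twelve_six_mul_add_one]
  push_cast
  ring

lemma kroneckerSummand_six_mul_add_five (n m : ℕ) : kroneckerSummand n (6 * m + 5) =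
    -((-1) ^ m * (6 * m + 5) * if m ^ 2 + triangular m + (2 * m + 1) ≤ n then
      (Fintype.card (n - (m ^ 2 + triangular m + (2 * m + 1))).Partition : ℚ) else 0) := by
  have h : ((n : ℚ) - (((6 * m + 5 : ℕ) : ℚ) ^ 2 - 1) / 24) =
      (n : ℚ) - ((m ^ 2 + triangular m + (2 * m + 1) : ℕ) : ℚ) := by
    push_cast
    rw [triangular_cast]
    ring
  rw [kroneckerSummand, h, partitionCount_natCast_sub, kroneckerSymbol_twelve_six_mul_add_five]
  push_cast
  ring

lemma kroneckerSummand_eq_zero {n k : ℕ} (h : kroneckerSymbol 12 k = 0) :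
    kroneckerSummand n k = 0 := by
  simp [kroneckerSummand, h]

/-- Only the indices `k ≡ ±1` modulo `6` contribute. -/
lemma sum_kroneckerSummand_range (n N : ℕ) : ∑ k ∈ range (6 * N), kroneckerSummand n k =
    ∑ m ∈ range N, (kroneckerSummand n (6 * m + 1) + kroneckerSummand n (6 * m + 5)) := by
  induction N with
  | zero => simp
  | succ N ih =>
    have h0 : kroneckerSummand n (6 * N) = 0 := by
      rcases Nat.eq_zero_or_pos N with rfl | hN
      · simp [kroneckerSummand]
      · exact kroneckerSummand_eq_zero (kroneckerSymbol_twelve_even (by omega) (by omega))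
    have h2 : kroneckerSummand n (6 * N + 2) = 0 :=
      kroneckerSummand_eq_zero (kroneckerSymbol_twelve_even (by omega) (by omega))
    have h3 : kroneckerSummand n (6 * N + 3) = 0 :=
      kroneckerSummand_eq_zero (kroneckerSymbol_twelve_six_mul_add_three N)
    have h4 : kroneckerSummand n (6 * N + 4) = 0 :=
      kroneckerSummand_eq_zero (kroneckerSymbol_twelve_even (by omega) (by omega))
    rw [show 6 * (N + 1) = 6 * N + 1 + 1 + 1 + 1 + 1 + 1 by ring]
    simp only [sum_range_succ, ih, add_assoc, Nat.reduceAdd]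
    rw [h0, h2, h3, h4]
    ring

/-- The terms with `k > √(24 n + 1)` vanish, as the argument of the partition function is
negative. -/
lemma sum_kroneckerSummand_Icc {n N : ℕ} (h : n < N) :
    ∑ k ∈ Icc 1 (Nat.sqrt (24 * n + 1)), kroneckerSummand n k =
      ∑ k ∈ range (6 * N), kroneckerSummand n k := by
  refine sum_subset (fun k hk ↦ ?_) fun k _ hk ↦ ?_
  · have h1 := Nat.le_sqrt.mp (mem_Icc.mp hk).2
    rw [mem_range]
    nlinarith
  · rcases Nat.eq_zero_or_pos k with rfl | hpos
    · simp [kroneckerSummand]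
    · have h1 : Nat.sqrt (24 * n + 1) < k := by
        rw [mem_Icc] at hk
        omega
      have h2 : 24 * n + 1 < k * k := Nat.sqrt_lt.mp h1
      have h3 : (24 * n + 1 : ℚ) < k * k := by exact_mod_cast h2
      rw [kroneckerSummand, partitionCount_of_neg (by linarith)]
      simp

open PowerSeries

/-- The product of `1 / (X; X)_∞` with the series of derivatives generates the sum over `k` of the
theorem's right-hand side. -/
lemma coeff_prod_mul_partialTheta {n N : ℕ} (h : n < N) :
    coeff n ((∏ i ∈ range N, geometricSeries i) *
      ∑ m ∈ range N, (-1) ^ m * (X : ℚ⟦X⟧) ^ (m ^ 2 + triangular m) *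
        ((6 * (m : ℚ⟦X⟧) + 1) - (6 * (m : ℚ⟦X⟧) + 5) * X ^ (2 * m + 1))) =
      ∑ k ∈ Icc 1 (Nat.sqrt (24 * n + 1)), kroneckerSummand n k := by
  rw [sum_kroneckerSummand_Icc h, sum_kroneckerSummand_range, mul_sum, map_sum]
  refine sum_congr rfl fun m _ ↦ ?_
  rw [kroneckerSummand_six_mul_add_one, kroneckerSummand_six_mul_add_five]
  have hterm : (∏ i ∈ range N, geometricSeries i) *
      ((-1) ^ m * (X : ℚ⟦X⟧) ^ (m ^ 2 + triangular m) *
        ((6 * (m : ℚ⟦X⟧) + 1) - (6 * (m : ℚ⟦X⟧) + 5) * X ^ (2 * m + 1))) =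
      C ((-1) ^ m * (6 * m + 1) : ℚ) *
        (X ^ (m ^ 2 + triangular m) * ∏ i ∈ range N, geometricSeries i) +
      C (-((-1) ^ m * (6 * m + 5)) : ℚ) *
        (X ^ (m ^ 2 + triangular m + (2 * m + 1)) * ∏ i ∈ range N, geometricSeries i) := by
    simp only [map_mul, map_neg, map_pow, map_add, map_natCast, map_ofNat, map_one]
    ring
  rw [hterm, map_add, coeff_C_mul, coeff_C_mul, coeff_X_pow_mul', coeff_X_pow_mul',
    coeff_prod_geometricSeries (by omega), coeff_prod_geometricSeries (by omega)]
  ring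

/-- The generating function identity for power series, up to order `N`. -/
lemma X_pow_dvd_weighted_sum {N : ℕ} (hN : 0 < N) :
    (X : ℚ⟦X⟧) ^ N ∣ 2 * (∑ l ∈ range N, X ^ ((l + 1) * (l + 2)) *
        (∏ i ∈ range (l + 1), geometricSeries i) ^ 2 * geometricSeries l) -
      (1 - 4 * lambertSum geometricSeries X N - (∏ i ∈ range N, geometricSeries i) *
        ∑ n ∈ range N, (-1) ^ n * X ^ (n ^ 2 + triangular n) *
          ((6 * (n : ℚ⟦X⟧) + 1) - (6 * (n : ℚ⟦X⟧) + 5) * X ^ (2 * n + 1))) := by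
  rw [← Ideal.mem_span_singleton, ← Ideal.Quotient.mk_eq_mk_iff_sub_mem]
  set φ := Ideal.Quotient.mk (Ideal.span {(X : ℚ⟦X⟧) ^ N}) with hφ
  have hq : φ X ^ N = 0 := by
    rw [← map_pow, hφ, Ideal.Quotient.eq_zero_iff_mem]
    exact Ideal.mem_span_singleton_self _
  have hv : ∀ i, φ (geometricSeries i) * (1 - φ X ^ (i + 1)) = 1 := fun i ↦ by
    rw [← map_pow, ← map_one φ, ← map_sub, ← map_mul, geometricSeries_mul]
  have h := weighted_sum_identity hN hq hv
  have hP := prod_mul_qPochhammer (z := 1) (w := fun i ↦ φ (geometricSeries i)) (q := φ X)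
    (by simpa using hv) N
  simp only [lambertSum, map_mul, map_sub, map_sum, map_pow, map_prod, map_add, map_neg, map_one,
    map_ofNat, map_natCast] at h ⊢
  set P := qPochhammer 1 (φ X) N
  set W := ∑ l ∈ range N, φ X ^ ((l + 1) * (l + 2)) *
        (∏ i ∈ range (l + 1), φ (geometricSeries i)) ^ 2 * φ (geometricSeries l)
  set a := ∏ i ∈ range N, φ (geometricSeries i)
  set H := ∑ i ∈ range N, φ X ^ (i + 1) * φ (geometricSeries i)
  linear_combination a * h + (-2 * W + 1 - 4 * H) * hP

end PartitionSum

theorem corollary2p11 (n : ℕ) (hn : 1 ≤ n) :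
    weightedCount n =
      -2 * (n.divisors.card : ℚ) -
        1 / 2 * ∑ k ∈ Finset.Icc 1 (Nat.sqrt (24 * n + 1)),
          (k : ℚ) * (kroneckerSymbol 12 k : ℚ) *
            (partitionCount ((n : ℚ) - ((k : ℚ) ^ 2 - 1) / 24) : ℚ) := by
  have h := PowerSeries.X_pow_dvd_iff.mp (X_pow_dvd_weighted_sum n.succ_pos) n n.lt_succ_self
  have hC : ∀ (r : ℕ) [r.AtLeastTwo] (f : PowerSeries ℚ),
      PowerSeries.coeff n ((OfNat.ofNat r : PowerSeries ℚ) * f) =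
        (OfNat.ofNat r : ℚ) * PowerSeries.coeff n f := fun r _ f ↦ by
    rw [← map_ofNat (PowerSeries.C (R := ℚ)), PowerSeries.coeff_C_mul]
  rw [map_sub, map_sub, map_sub, hC, hC, ← weightedCount_eq_coeff hn n.le_succ,
    coeff_lambertSum (by omega) n.le_succ, coeff_prod_mul_partialTheta n.lt_succ_self,
    PowerSeries.coeff_one, if_neg (by omega)] at h
  simp only [kroneckerSummand] at h
  linarith
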